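/- **Theorem 7.2.** A *global transfer system* for a family $\mathcal F$ of compact Lie groups (such as the family AbLie of abelian compact Lie groups, or the family Cyc of finite cyclic groups with the discrete topology) is a partial order $\leqslant_T$ on $\mathcal F$ such that $K \leqslant_T H$ implies that $K$ is a finite index closed subgroup of $H$, and such that for all $G, H, K \in \mathcal F$ and every continuous homomorphism $\theta \colon G \to H$, $K \leqslant_T H$ implies $\theta^{-1}(K) \leqslant_T G$. Let $I_{\mathcal F}$ denote the poset of global transfer systems for $\mathcal F$, ordered by inclusion: $T \subseteq T'$ means that $K \leqslant_T H$ implies $K \leqslant_{T'} H$. Restricting a transfer system from abelian compact Lie groups to finite cyclic groups defines an isomorphism of posets $I_{\mathrm{AbLie}} \cong I_{\mathrm{Cyc}}$, and there is an isomorphism of posets $I_{\mathrm{Cyc}} \cong \bigl(\prod_{p \text{ prime}} (\mathbb N \cup \{\infty\})\bigr)^{\mathrm{op}}$, where the product is ordered componentwise, such that the following holds. Let $N = (N_p)_p \in \prod_{p} (\mathbb N \cup \{\infty\})$, regarded as the generalized natural number $\prod_p p^{N_p}$, and let $T^N \in I_{\mathrm{AbLie}}$ be the transfer system that corresponds to $N$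 under the composite of these isomorphisms. Then for every abelian compact Lie group $H$ and every closed subgroup $K$ of finite index in $H$, $K \leqslant_{T^N} H$ if and only if $K$ contains every element of $H$ of finite order whose order divides $N$; here a nonzero natural number $m$ divides $N$ if $v_p(m) \leqslant N_p$ for every prime $p$. -/

import Mathlib

universe u

namespace GlobalTransfer

open scoped Manifold ContDiff

/-- A class of groups equipped with a topology. -/
abbrev TopGroupClass : Type (u + 1) :=
  ∀ (G : Type u) [Group G] [TopologicalSpace G], Prop

/-- `G` is a compact Lie group: compact, Hausdorff, and it carries the structure of a
finite-dimensional real smooth manifold (without boundary) for which multiplication and inversion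
are smooth. (Every continuous homomorphism of Lie groups is smooth, so this smooth structure is
unique, and being a Lie group is a property of the topological group.) -/
def IsCompactLieGroup (G : Type u) [Group G] [TopologicalSpace G] : Prop :=
  CompactSpace G ∧ T2Space G ∧
    ∃ (n : ℕ) (_ : ChartedSpace (EuclideanSpace ℝ (Fin n)) G), LieGroup (𝓡 n) ∞ G

/-- The class of abelian compact Lie groups. -/
def AbLie : TopGroupClass.{u} := fun G _ _ =>
  IsCompactLieGroup G ∧ ∀ a b : G, a * b = b * a

/-- The class of finite cyclic groups, with the discrete topology. -/
def Cyc : TopGroupClass.{u} := fun G _ _ =>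
  Finite G ∧ DiscreteTopology G ∧ IsCyclic G

/-- A global transfer system for a class `F` of compact Lie groups: a partial order on `F` which
refines the relation "is a finite index closed subgroup of", and which is closed under pullback
along continuous homomorphisms between members of `F`. Since related groups are a group and one of
its subgroups, the relation is given by the subgroups `K` of `H` with `K ≤_T H`, where `K` carries
the subspace topology; antisymmetry is then automatic. -/
@[ext]
structure TransferSystem (F : TopGroupClass.{u}) : Type (u + 1) where
  /-- `rel H K` says that `K ≤_T H`. -/
  rel : ∀ (H : Type u) [Group H] [TopologicalSpace H], Subgroup H → Prop
  /-- The larger group belongs to the class. -/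
  mem_right : ∀ {H : Type u} [Group H] [TopologicalSpace H] {K : Subgroup H}, rel H K → F H
  /-- The smaller group belongs to the class. -/
  mem_left : ∀ {H : Type u} [Group H] [TopologicalSpace H] {K : Subgroup H}, rel H K → F K
  isClosed : ∀ {H : Type u} [Group H] [TopologicalSpace H] {K : Subgroup H},
    rel H K → IsClosed (K : Set H)
  finiteIndex : ∀ {H : Type u} [Group H] [TopologicalSpace H] {K : Subgroup H},
    rel H K → K.FiniteIndex
  refl : ∀ (H : Type u) [Group H] [TopologicalSpace H], F H → rel H ⊤
  trans : ∀ {H : Type u} [Group H] [TopologicalSpace H] {L K : Subgroup H},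
    L ≤ K → rel K (L.subgroupOf K) → rel H K → rel H L
  pullback : ∀ {G H : Type u} [Group G] [TopologicalSpace G] [Group H] [TopologicalSpace H]
    {K : Subgroup H}, F G → ∀ θ : G →* H, Continuous θ → rel H K → rel G (K.comap θ)

/-- Transfer systems for `F` are ordered by inclusion of relations. -/
instance (F : TopGroupClass.{u}) : PartialOrder (TransferSystem F) where
  le T T' := ∀ (H : Type u) [Group H] [TopologicalSpace H] (K : Subgroup H),
    T.rel H K → T'.rel H K
  le_refl _ _ _ _ _ h := h
  le_trans _ _ _ h h' H _ _ K hK := h' H K (h H K hK)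
  le_antisymm T T' h h' := by
    ext H _ _ K
    exact ⟨h H K, h' H K⟩

/-- A generalized natural number `∏ p ^ N p`, with exponents in `ℕ ∪ {∞}`. -/
abbrev GenNat : Type := Nat.Primes → ℕ∞

/-- The natural number `m` is nonzero and divides the generalized natural number `N`. -/
def DividesGen (m : ℕ) (N : GenNat) : Prop :=
  m ≠ 0 ∧ ∀ p : Nat.Primes, (m.factorization p : ℕ∞) ≤ N p

end GlobalTransfer

open GlobalTransfer

/-!
Let `T` be a transfer system on abelian compact Lie groups, or on finite cyclic groups. For a prime
`p`, let `N p` be the least `j` such that the subgroup of order `p ^ j` of the cyclic group of order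
`p ^ (j + 1)` is related to the whole group. Everything follows from the fact that these numbers
determine `T`: a closed subgroup `K` of finite index in `H` is related to `H` exactly when it
contains every element whose order divides `N` (`TransferSystem.rel_iff`).

If `K` is related to `H` and misses an element of order dividing `N`, then it misses some `y` of
prime power order `p ^ (k + 1)` dividing `N` with `y ^ p ∈ K`. Pulling `K` back to the cyclic group
generated by `y` gives `N p ≤ k`, a contradiction (`TransferSystem.mem_of_rel`).

Conversely, transitivity reduces to the case where `K` has prime index `p` in `H`. A compact
abelian Lie group has an open divisible identity component, because its power maps are open at the
identity (`map_pow_nhds_one`). Hence `K` misses an element of `p`-power order, so `j := N p` is finite,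
and `K` contains the `p ^ j`-torsion. A character `χ` of `H` with kernel `K` therefore
kills the `p ^ j`-torsion, so it is `p ^ j` times another character `ψ`, as `ℚ / ℤ` is divisible.
Then `ψ` has values in the cyclic group of order `p ^ (j + 1)`, it is continuous since it kills the
divisible identity component, and `K` is the preimage under `ψ` of the subgroup of order `p ^ j`
(`TransferSystem.rel_of_index_prime`, `TransferSystem.rel_of_forall_mem`).

Any `N` occurs (`TransferSystem.ofGenNat`, `TransferSystem.exponent_ofGenNat`), so both posets
of transfer systems are isomorphic to that of generalized natural numbers with the reversed order,
by the same formula; restriction is compatible with these isomorphisms.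
-/

namespace GlobalTransfer

open scoped Manifold ContDiff
open Filter Topology

/-! ### Compact Lie groups: powers near the identity -/

/-- The `k`-th power map of a Lie group is open at the identity when `k ≠ 0`: read in a chart, its
derivative at the identity is multiplication by `k`, so the inverse function theorem applies. -/
theorem map_pow_nhds_one (n : ℕ) {G : Type u} [CommGroup G] [TopologicalSpace G]
    [ChartedSpace (EuclideanSpace ℝ (Fin n)) G] [LieGroup (𝓡 n) ∞ G] {k : ℕ} (hk : k ≠ 0) :
    map (fun x : G => x ^ k) (𝓝 1) = 𝓝 1 := by
  set E := EuclideanSpace ℝ (Fin n)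
  have : IsTopologicalGroup G := topologicalGroup_of_lieGroup (𝓡 n) ∞
  set φ := chartAt E (1 : G)
  have h1 : (1 : G) ∈ φ.source := mem_chart_source E (1 : G)
  set a : E := φ 1
  have ha : a ∈ φ.target := φ.map_source h1
  have hsa : φ.symm a = 1 := φ.left_inv h1
  have hφ : ContMDiffAt (𝓡 n) (𝓡 n) ∞ φ (1 : G) := contMDiffAt_of_mem_maximalAtlas
    (IsManifold.chart_mem_maximalAtlas (1 : G)) h1
  have hφs : ContMDiffAt (𝓡 n) (𝓡 n) ∞ φ.symm a := contMDiffAt_symm_of_mem_maximalAtlas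
    (IsManifold.chart_mem_maximalAtlas (1 : G)) ha
  -- multiplication and powers, read in the chart
  let m : E × E → E := fun q => φ (φ.symm q.1 * φ.symm q.2)
  let g : ℕ → E → E := fun j x => φ (φ.symm x ^ j)
  have hm : DifferentiableAt ℝ m (a, a) := by
    have : ContMDiffAt 𝓘(ℝ, E × E) (𝓡 n) ∞ m (a, a) := by
      have hf : ContMDiffAt 𝓘(ℝ, E × E) (𝓡 n) ∞ (fun q : E × E => φ.symm q.1) (a, a) :=
        ContMDiffAt.comp (a, a) (g := φ.symm) hφs contDiff_fst.contMDiff.contMDiffAt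
      have hs : ContMDiffAt 𝓘(ℝ, E × E) (𝓡 n) ∞ (fun q : E × E => φ.symm q.2) (a, a) :=
        ContMDiffAt.comp (a, a) (g := φ.symm) hφs contDiff_snd.contMDiff.contMDiffAt
      refine ContMDiffAt.comp (a, a) (g := φ) ?_ (hf.mul hs)
      simpa [hsa] using hφ
    exact (contMDiffAt_iff_contDiffAt.1 this).differentiableAt (by simp)
  have hg : ∀ j, ContDiffAt ℝ ∞ (g j) a := by
    intro j
    have : ContMDiffAt (𝓡 n) (𝓡 n) ∞ (g j) a := by
      refine ContMDiffAt.comp a (g := φ) ?_ (hφs.pow j)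
      simpa [hsa] using hφ
    exact contMDiffAt_iff_contDiffAt.1 this
  have hga : ∀ j, g j a = a := fun j => by simp [g, hsa, a]
  have htar : ∀ᶠ x in 𝓝 a, x ∈ φ.target := φ.open_target.mem_nhds ha
  -- the derivative of multiplication at the identity is addition
  have hD : ∀ u v : E, fderiv ℝ m (a, a) (u, v) = u + v := by
    have hid : ∀ (f : E → E), f =ᶠ[𝓝 a] id → HasFDerivAt f (ContinuousLinearMap.id ℝ E) a :=
      fun f hf => (hasFDerivAt_id a).congr_of_eventuallyEq hf
    have hl : (fderiv ℝ m (a, a)).comp (ContinuousLinearMap.inl ℝ E E) =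
        ContinuousLinearMap.id ℝ E := by
      refine HasFDerivAt.unique (HasFDerivAt.comp a (g := m) (f := fun x => (x, a))
        hm.hasFDerivAt (hasFDerivAt_prodMk_left a a)) (hid _ ?_)
      filter_upwards [htar] with x hx
      simp [m, hsa, φ.right_inv hx]
    have hr : (fderiv ℝ m (a, a)).comp (ContinuousLinearMap.inr ℝ E E) =
        ContinuousLinearMap.id ℝ E := by
      refine HasFDerivAt.unique (HasFDerivAt.comp a (g := m) (f := fun x => (a, x))
        hm.hasFDerivAt (hasFDerivAt_prodMk_right a a)) (hid _ ?_)
      filter_upwards [htar] with x hx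
      simp [m, hsa, φ.right_inv hx]
    intro u v
    have hu := DFunLike.congr_fun hl u
    have hv := DFunLike.congr_fun hr v
    simp only [ContinuousLinearMap.comp_apply, ContinuousLinearMap.inl_apply,
      ContinuousLinearMap.inr_apply, ContinuousLinearMap.id_apply] at hu hv
    rw [show ((u, v) : E × E) = (u, 0) + (0, v) by simp, map_add, hu, hv]
  have hgd : ∀ j, HasFDerivAt (g j) ((j : ℝ) • ContinuousLinearMap.id ℝ E) a := by
    intro j
    induction j with
    | zero =>
      have h0 : g 0 = fun _ => a := by simp [g, a]
      rw [h0]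
      refine (hasFDerivAt_const a a).congr_fderiv ?_
      ext1 v
      change (0 : E) = ((0 : ℕ) : ℝ) • v
      rw [Nat.cast_zero, zero_smul]
    | succ j ih =>
      have hcomp : HasFDerivAt (fun x => m (g j x, x)) ((fderiv ℝ m (a, a)).comp
          (((j : ℝ) • ContinuousLinearMap.id ℝ E).prod (ContinuousLinearMap.id ℝ E))) a := by
        refine HasFDerivAt.comp a (g := m) (f := fun x => (g j x, x)) ?_
          (ih.prodMk (hasFDerivAt_id a))
        simpa [hga] using hm.hasFDerivAt
      have heq : g (j + 1) =ᶠ[𝓝 a] fun x => m (g j x, x) := by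
        have hc : ContinuousAt (fun x => φ.symm x ^ j) a :=
          (φ.symm.continuousAt (by simpa using ha)).pow j
        have : ∀ᶠ x in 𝓝 a, φ.symm x ^ j ∈ φ.source :=
          hc.eventually (by simpa [hsa] using φ.open_source.mem_nhds h1)
        filter_upwards [this] with x hx
        simp [m, g, φ.left_inv hx, pow_succ]
      refine (hcomp.congr_of_eventuallyEq heq).congr_fderiv ?_
      ext1 v
      simp [hD, add_smul]
  have hstrict : HasStrictFDerivAt (g k) ((k : ℝ) • ContinuousLinearMap.id ℝ E) a := by
    have := (hg k).hasStrictFDerivAt (by simp)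
    rwa [(hgd k).fderiv] at this
  have hmap : map (g k) (𝓝 a) = 𝓝 a := by
    have := hstrict.map_nhds_eq_of_surj (by
      rw [LinearMap.range_eq_top]
      intro v
      refine ⟨(k : ℝ)⁻¹ • v, ?_⟩
      simp [smul_smul, hk])
    rwa [hga] at this
  have hpow : (fun x : G => x ^ k) =ᶠ[𝓝 1] φ.symm ∘ g k ∘ φ := by
    have hc : ∀ᶠ x : G in 𝓝 1, x ^ k ∈ φ.source :=
      (continuous_pow k).continuousAt.eventually (by simpa using φ.open_source.mem_nhds h1)
    filter_upwards [hc, φ.open_source.mem_nhds h1] with x hx hx'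
    simp [g, φ.left_inv hx, φ.left_inv hx']
  rw [map_congr hpow, ← map_map, ← map_map, φ.map_nhds_eq h1, hmap,
    φ.symm.map_nhds_eq (by simpa using ha), hsa]

/-- An open subgroup of a compact Lie group which is closed is a compact Lie group. -/
theorem IsCompactLieGroup.subgroup {H : Type u} [Group H] [TopologicalSpace H]
    (hH : IsCompactLieGroup H) {K : Subgroup H} (hc : IsClosed (K : Set H))
    (ho : IsOpen (K : Set H)) : IsCompactLieGroup K := by
  obtain ⟨hcpt, ht2, n, hcs, hlie⟩ := hH
  refine ⟨isCompact_iff_compactSpace.1 hc.isCompact, inferInstance, n, ?_⟩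
  let U : TopologicalSpace.Opens H := ⟨K, ho⟩
  refine ⟨inferInstanceAs (ChartedSpace (EuclideanSpace ℝ (Fin n)) U), ?_⟩
  let : Group U := inferInstanceAs (Group K)
  suffices LieGroup (𝓡 n) ∞ U from this
  have hv : ContMDiff (𝓡 n) (𝓡 n) ∞ (Subtype.val : U → H) := contMDiff_subtype_val
  refine { contMDiff_mul := ?_, contMDiff_inv := ?_ }
  · rw [← ContMDiff.subtypeVal_comp_iff]
    exact (hv.comp contMDiff_fst).mul (hv.comp contMDiff_snd)
  · rw [← ContMDiff.subtypeVal_comp_iff]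
    exact hv.inv

theorem isCompactLieGroup_of_finite {H : Type u} [Group H] [TopologicalSpace H]
    [Finite H] [DiscreteTopology H] : IsCompactLieGroup H := by
  refine ⟨inferInstance, inferInstance, 0, ChartedSpace.ofDiscreteTopology, ?_⟩
  let : ChartedSpace (EuclideanSpace ℝ (Fin 0)) H := ChartedSpace.ofDiscreteTopology
  exact { toIsManifold := IsManifold.of_discreteTopology _
          contMDiff_mul := contMDiff_of_discreteTopology
          contMDiff_inv := contMDiff_of_discreteTopology }

/-- An abelian compact Lie group has a divisible open subgroup which lies in every open subgroup
(namely, the identity component). -/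
theorem AbLie.exists_divisible {H : Type u} [CommGroup H] [TopologicalSpace H]
    (hH : AbLie H) : ∃ D : Subgroup H, IsOpen (D : Set H) ∧
      (∀ K : Subgroup H, IsOpen (K : Set H) → D ≤ K) ∧
      ∀ k : ℕ, k ≠ 0 → ∀ x ∈ D, ∃ y ∈ D, y ^ k = x := by
  obtain ⟨⟨hcpt, ht2, n, hcs, hlie⟩, -⟩ := hH
  have : IsTopologicalGroup H := topologicalGroup_of_lieGroup (𝓡 n) ∞
  have : LocallyConnectedSpace H :=
    ChartedSpace.locallyConnectedSpace (EuclideanSpace ℝ (Fin n)) H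
  have hD : IsOpen (Subgroup.connectedComponentOfOne H : Set H) := isOpen_connectedComponent
  have hle : ∀ K : Subgroup H, IsOpen (K : Set H) → Subgroup.connectedComponentOfOne H ≤ K := by
    intro K hK
    exact IsClopen.connectedComponent_subset ⟨K.isClosed_of_isOpen hK, hK⟩ K.one_mem
  refine ⟨Subgroup.connectedComponentOfOne H, hD, hle, fun k hk x hx => ?_⟩
  -- the `k`-th powers form an open subgroup, which therefore contains the connected group
  have hopen : IsOpen (((Subgroup.connectedComponentOfOne H).map (powMonoidHom k) :
      Subgroup H) : Set H) := by
    refine Subgroup.isOpen_of_mem_nhds _ (g := 1) ?_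
    rw [← map_pow_nhds_one n hk]
    exact image_mem_map (hD.mem_nhds (Subgroup.one_mem _))
  exact hle _ hopen hx

/-! ### Subgroups of prime index in abelian groups -/

/-- A character of an abelian group which vanishes on the `n`-torsion is `n` times another
character, because `ℚ / ℤ` is divisible. -/
theorem exists_nsmul_eq_of_torsion_le {A : Type u} [AddCommGroup A] {n : ℕ}
    (χ : A →+ AddCircle (1 : ℚ)) (hχ : ∀ x : A, n • x = 0 → χ x = 0) :
    ∃ ψ : A →+ AddCircle (1 : ℚ), ∀ x, n • ψ x = χ x := by
  let m : A →+ A := nsmulAddMonoidHom n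
  let χ' : m.range →+ AddCircle (1 : ℚ) :=
    (QuotientAddGroup.lift m.ker χ fun x hx => hχ x hx).comp
      (QuotientAddGroup.quotientKerEquivRange m).symm.toAddMonoidHom
  obtain ⟨ψ, hψ⟩ := CharacterModule.dual_surjective_of_injective
    (m.range.subtype.toIntLinearMap) m.range.subtype_injective χ'
  refine ⟨ψ, fun x => ?_⟩
  have h1 : ψ (m x) = χ' ⟨m x, x, rfl⟩ := DFunLike.congr_fun hψ ⟨m x, x, rfl⟩
  have h2 : (QuotientAddGroup.quotientKerEquivRange m).symm ⟨m x, x, rfl⟩ =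
      (QuotientAddGroup.mk x : A ⧸ m.ker) := by
    rw [AddEquiv.symm_apply_eq]; rfl
  have h3 : χ' ⟨m x, x, rfl⟩ = χ x := by
    change QuotientAddGroup.lift m.ker χ (fun x hx => hχ x hx)
      ((QuotientAddGroup.quotientKerEquivRange m).symm ⟨m x, x, rfl⟩) = χ x
    rw [h2]; rfl
  rw [← h3, ← h1]
  exact (map_nsmul ψ n x).symm

/-- A character killed by `n` can be viewed as a homomorphism to `ZMod n`, because the `n`-torsion of
`ℚ / ℤ` is cyclic of order `n`. -/
theorem exists_zmod_hom_of_nsmul_eq_zero {A : Type u} [AddCommGroup A] {n : ℕ} (hn : n ≠ 0)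
    (ψ : A →+ AddCircle (1 : ℚ)) (hψ : ∀ x, n • ψ x = 0) :
    ∃ φ : A →+ ZMod n, ∀ (k : ℕ) (x : A), k • φ x = 0 ↔ k • ψ x = 0 := by
  have : Fact ((0 : ℚ) < 1) := ⟨one_pos⟩
  let e : AddCircle (1 : ℚ) := ((1 / n : ℚ) : AddCircle (1 : ℚ))
  have hmem : ∀ x, ψ x ∈ AddSubgroup.zmultiples e := by
    intro x
    obtain ⟨m, -, hm⟩ := (AddCircle.nsmul_eq_zero_iff (Nat.pos_of_ne_zero hn)).1 (hψ x)
    refine AddSubgroup.mem_zmultiples_iff.2 ⟨m, ?_⟩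
    rw [← hm, natCast_zsmul, ← AddCircle.coe_nsmul]
    congr 1
    simp [div_eq_mul_inv]
  have hcard : Nat.card (AddSubgroup.zmultiples e) = n := by
    rw [Nat.card_zmultiples]
    exact AddCircle.addOrderOf_period_div (Nat.pos_of_ne_zero hn)
  let E : ZMod n ≃+ AddSubgroup.zmultiples e :=
    (ZMod.ringEquivCongr hcard.symm).toAddEquiv.trans
      (zmodAddCyclicAddEquiv (inferInstance : IsAddCyclic (AddSubgroup.zmultiples e)))
  refine ⟨E.symm.toAddMonoidHom.comp (ψ.codRestrict _ hmem), fun k x => ?_⟩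
  have : k • E.symm (ψ.codRestrict _ hmem x) = 0 ↔ k • ψ.codRestrict _ hmem x = 0 := by
    rw [← map_nsmul, EmbeddingLike.map_eq_zero_iff]
  refine Iff.trans this ?_
  rw [← Subtype.coe_inj]
  rfl

/-- A subgroup of prime index `p` of an abelian group which contains the `p ^ j`-torsion is the
preimage of the subgroup of index `p` under a homomorphism to a cyclic group of order
`p ^ (j + 1)`. -/
theorem exists_hom_zmod_of_index_prime {H : Type u} [CommGroup H] {K : Subgroup H} {p : ℕ}
    (hp : p.Prime) (hK : K.index = p) {j : ℕ} (htor : ∀ x : H, x ^ p ^ j = 1 → x ∈ K) :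
    ∃ φ : H →* Multiplicative (ZMod (p ^ (j + 1))), ∀ x, x ∈ K ↔ φ x ^ p ^ j = 1 := by
  -- a character with kernel `K`
  have hne : K ≠ ⊤ := fun h => hp.one_lt.ne' (by rw [← hK, h, Subgroup.index_top])
  obtain ⟨x₀, hx₀⟩ : ∃ x, x ∉ K := by
    by_contra! h
    exact hne ((Subgroup.eq_top_iff' K).2 h)
  obtain ⟨c, hc⟩ := CharacterModule.exists_character_apply_ne_zero_of_ne_zero
    (A := Additive (H ⧸ K)) (a := Additive.ofMul (x₀ : H ⧸ K))
    (fun h => hx₀ ((QuotientGroup.eq_one_iff x₀).1 h))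
  let χ : Additive H →+ AddCircle (1 : ℚ) :=
    AddMonoidHom.comp c (MonoidHom.toAdditive (QuotientGroup.mk' K))
  have hKχ : ∀ x ∈ K, χ (Additive.ofMul x) = 0 := by
    intro x hx
    have : (x : H ⧸ K) = 1 := (QuotientGroup.eq_one_iff x).2 hx
    change c (Additive.ofMul (x : H ⧸ K)) = 0
    rw [this]
    exact map_zero c
  let M : Subgroup H := (AddMonoidHom.toMultiplicativeRight χ).ker
  have hKM : K ≤ M := hKχ
  have hMK : M ≤ K := by
    have hmul := Subgroup.relIndex_mul_index hKM
    rw [hK] at hmul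
    rcases hp.eq_one_or_self_of_dvd _ (Dvd.intro_left _ hmul) with h | h
    · exact absurd (show x₀ ∈ M by rw [Subgroup.index_eq_one.1 h]; trivial) hc
    · rw [h] at hmul
      exact Subgroup.relIndex_eq_one.1 (Nat.eq_of_mul_eq_mul_right hp.pos (by simpa using hmul))
  have hχ : ∀ x : H, x ∈ K ↔ χ (Additive.ofMul x) = 0 := fun x => ⟨hKχ x, fun h => hMK h⟩
  obtain ⟨ψ, hψ⟩ := exists_nsmul_eq_of_torsion_le (n := p ^ j) χ fun x hx => hKχ _ (htor _ hx)
  have hψ' : ∀ x, p ^ (j + 1) • ψ x = 0 := by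
    intro x
    rw [pow_succ', mul_smul, hψ, ← map_nsmul]
    refine hKχ (x.toMul ^ p) ?_
    rw [← hK]
    exact K.pow_index_mem _
  obtain ⟨φ, hφ⟩ := exists_zmod_hom_of_nsmul_eq_zero (pow_ne_zero _ hp.ne_zero) ψ hψ'
  refine ⟨AddMonoidHom.toMultiplicativeRight φ, fun x => ?_⟩
  rw [hχ, ← hψ, ← hφ]
  rfl

/-- A proper subgroup of finite index of an abelian group has prime index in a larger subgroup. -/
theorem exists_relIndex_prime {H : Type u} [CommGroup H] {K : Subgroup H} [K.FiniteIndex]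
    (hK : K ≠ ⊤) : ∃ (p : ℕ) (L : Subgroup H), p.Prime ∧ K ≤ L ∧ K.relIndex L = p ∧
      L.index < K.index := by
  have h1 : K.index ≠ 1 := fun h => hK (Subgroup.index_eq_one.1 h)
  obtain ⟨p, hp, hdvd⟩ := Nat.exists_prime_and_dvd h1
  have : Fact p.Prime := ⟨hp⟩
  obtain ⟨Q, hQ⟩ := Sylow.exists_subgroup_card_pow_prime (G := H ⧸ K) p (n := 1)
    (by simpa [Subgroup.index] using hdvd)
  rw [pow_one] at hQ
  let L := Q.comap (QuotientGroup.mk' K)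
  have hKL : K ≤ L := by
    intro x hx
    change (x : H ⧸ K) ∈ Q
    rw [(QuotientGroup.eq_one_iff x).2 hx]
    exact Q.one_mem
  have hL : L.index = Q.index :=
    Subgroup.index_comap_of_surjective Q (QuotientGroup.mk'_surjective K)
  have hmul := Subgroup.relIndex_mul_index hKL
  have hcard : p * L.index = K.index := by rw [hL, ← hQ, Subgroup.card_mul_index]; rfl
  have hpos : 0 < L.index := by
    refine Nat.pos_of_ne_zero fun h => ?_
    rw [h, mul_zero] at hcard
    exact Subgroup.FiniteIndex.index_ne_zero hcard.symm
  refine ⟨p, L, hp, hKL, Nat.eq_of_mul_eq_mul_right hpos (by rw [hmul, hcard]), ?_⟩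
  rw [← hcard]
  nlinarith [hp.one_lt]

theorem mem_of_pow_mem_of_coprime {H : Type u} [Group H] {K : Subgroup H} {x : H} {m n : ℕ}
    (hmn : m.Coprime n) (hm : x ^ m ∈ K) (hn : x ^ n ∈ K) : x ∈ K := by
  have hb := Nat.gcd_eq_gcd_ab m n
  rw [hmn] at hb
  have hxe : x = (x ^ m) ^ (m.gcdA n) * (x ^ n) ^ (m.gcdB n) := by
    rw [← zpow_natCast, ← zpow_natCast, ← zpow_mul, ← zpow_mul, ← zpow_add, ← hb]
    simp
  rw [hxe]
  exact K.mul_mem (K.zpow_mem hm _) (K.zpow_mem hn _)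

/-- If a finite-order element `x` lies outside a subgroup, then some power `y` of `x` lies
outside as well, has prime power order `p ^ (k + 1)`, and satisfies `y ^ p ∈ K`. -/
theorem exists_prime_pow_order_not_mem {H : Type u} [Group H] {K : Subgroup H} {x : H}
    (hx : orderOf x ≠ 0) (hxK : x ∉ K) :
    ∃ (p k : ℕ) (y : H), p.Prime ∧ y ∉ K ∧ y ^ p ∈ K ∧ orderOf y = p ^ (k + 1) ∧
      orderOf y ∣ orderOf x := by
  induction hn : orderOf x using Nat.strong_induction_on generalizing x with
  | _ n ih =>
    subst hn
    have h1 : orderOf x ≠ 1 := fun h => hxK (by rw [orderOf_eq_one_iff.1 h]; exact K.one_mem)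
    by_cases hall : ∀ q : ℕ, q.Prime → q ∣ orderOf x → x ^ q ∈ K
    · obtain ⟨p, hp, hdvd⟩ := Nat.exists_prime_and_dvd h1
      have huniq : ∀ {q : ℕ}, q.Prime → q ∣ orderOf x → q = p := by
        intro q hq hqd
        by_contra hne
        exact hxK (mem_of_pow_mem_of_coprime ((Nat.coprime_primes hp hq).2 (Ne.symm hne))
          (hall p hp hdvd) (hall q hq hqd))
      have hpow := Nat.eq_prime_pow_of_unique_prime_dvd hx huniq
      obtain ⟨k, hk⟩ : ∃ k, (orderOf x).primeFactorsList.length = k + 1 := by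
        refine Nat.exists_eq_succ_of_ne_zero fun h => h1 ?_
        rw [hpow, h, pow_zero]
      exact ⟨p, k, x, hp, hxK, hall p hp hdvd, by rw [hpow, hk], dvd_rfl⟩
    · push Not at hall
      obtain ⟨q, hq, hqd, hqK⟩ := hall
      have hord : orderOf (x ^ q) = orderOf x / q := orderOf_pow_of_dvd hq.ne_zero hqd
      have hlt : orderOf (x ^ q) < orderOf x := by
        rw [hord]
        exact Nat.div_lt_self (Nat.pos_of_ne_zero hx) hq.one_lt
      have hdv : orderOf (x ^ q) ∣ orderOf x := orderOf_pow_dvd q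
      obtain ⟨p, k, y, hp, h2, h3, h4, h5⟩ :=
        ih _ hlt (fun h => hx (by rw [h] at hdv; exact zero_dvd_iff.1 hdv)) hqK rfl
      exact ⟨p, k, y, hp, h2, h3, h4, h5.trans hdv⟩

/-! ### Classes of abelian compact Lie groups -/

/-- A class of abelian compact Lie groups which contains the finite cyclic groups and is closed
under closed subgroups of finite index. The classification of transfer systems is the same for all
such classes. -/
structure IsAbelianLieClass (F : TopGroupClass.{u}) : Prop where
  of_cyc : ∀ {G : Type u} [Group G] [TopologicalSpace G], Cyc G → F G
  abLie : ∀ {G : Type u} [Group G] [TopologicalSpace G], F G → AbLie G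
  subgroup : ∀ {H : Type u} [Group H] [TopologicalSpace H] {K : Subgroup H}, F H →
    IsClosed (K : Set H) → K.FiniteIndex → F K

theorem AbLie.isTopologicalGroup {H : Type u} [Group H] [TopologicalSpace H] (hH : AbLie H) :
    IsTopologicalGroup H := by
  obtain ⟨⟨-, -, n, _, _⟩, -⟩ := hH
  exact topologicalGroup_of_lieGroup (𝓡 n) ∞

theorem isAbelianLieClass_abLie : IsAbelianLieClass AbLie.{u} where
  of_cyc := by
    rintro G _ _ ⟨_, _, _⟩
    refine ⟨isCompactLieGroup_of_finite, fun a b => ?_⟩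
    let _ : CommGroup G := IsCyclic.commGroup
    exact mul_comm a b
  abLie := id
  subgroup := by
    intro H _ _ K hH hc _
    have := hH.isTopologicalGroup
    exact ⟨hH.1.subgroup hc (K.isOpen_of_isClosed_of_finiteIndex hc),
      fun a b => Subtype.ext (hH.2 a b)⟩

theorem isAbelianLieClass_cyc : IsAbelianLieClass Cyc.{u} where
  of_cyc := id
  abLie := isAbelianLieClass_abLie.of_cyc
  subgroup := by
    rintro H _ _ K ⟨_, _, _⟩ - -
    exact ⟨inferInstance, inferInstance, inferInstance⟩

/-- Every open proper subgroup of an abelian compact Lie group misses an element of finite order: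
some power of any element lies in the divisible identity component. -/
theorem AbLie.exists_orderOf_ne_zero_not_mem {H : Type u} [CommGroup H] [TopologicalSpace H]
    (hH : AbLie H) {K : Subgroup H} (ho : IsOpen (K : Set H)) (hK : K ≠ ⊤) :
    ∃ y, orderOf y ≠ 0 ∧ y ∉ K := by
  obtain ⟨x, hx⟩ : ∃ x, x ∉ K := by
    by_contra! h
    exact hK ((Subgroup.eq_top_iff' K).2 h)
  have := hH.isTopologicalGroup
  have : CompactSpace H := hH.1.1
  obtain ⟨D, hDo, hDle, hDdiv⟩ := hH.exists_divisible
  have : Finite (H ⧸ D) := D.quotient_finite_of_isOpen hDo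
  have hn : D.index ≠ 0 := D.finiteIndex_of_finite_quotient.index_ne_zero
  obtain ⟨d, hd, hdx⟩ := hDdiv _ hn _ (D.pow_index_mem x)
  refine ⟨x * d⁻¹, ?_, fun h => hx ?_⟩
  · rw [ne_eq, orderOf_eq_zero_iff, not_not]
    refine isOfFinOrder_iff_pow_eq_one.2 ⟨D.index, Nat.pos_of_ne_zero hn, ?_⟩
    rw [mul_pow, inv_pow, hdx, mul_inv_cancel]
  · simpa using K.mul_mem h (hDle K ho hd)

/-! ### Divisibility of generalized natural numbers -/

theorem DividesGen.of_dvd {m n : ℕ} {N : GenNat} (h : m ∣ n) (hn : DividesGen n N) :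
    DividesGen m N := by
  refine ⟨ne_zero_of_dvd_ne_zero hn.1 h, fun p => le_trans ?_ (hn.2 p)⟩
  exact_mod_cast (Nat.factorization_le_iff_dvd (ne_zero_of_dvd_ne_zero hn.1 h) hn.1).2 h p

theorem DividesGen.mono {m : ℕ} {N N' : GenNat} (h : N ≤ N') (hm : DividesGen m N) :
    DividesGen m N' :=
  ⟨hm.1, fun p => (hm.2 p).trans (h p)⟩

theorem dividesGen_prime_pow_iff {p : Nat.Primes} {k : ℕ} {N : GenNat} :
    DividesGen ((p : ℕ) ^ k) N ↔ (k : ℕ∞) ≤ N p := by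
  refine ⟨fun h => ?_, fun h => ⟨pow_ne_zero _ p.2.ne_zero, fun q => ?_⟩⟩
  · simpa [p.2.factorization_pow] using h.2 p
  · rw [p.2.factorization_pow]
    by_cases hq : (q : ℕ) = p
    · obtain rfl : q = p := Subtype.ext hq
      simpa using h
    · simp [Ne.symm hq]

/-! ### The exponents of a transfer system -/

/-- The cyclic group of order `p ^ (j + 1)`, as a discrete group in the universe `u`. -/
abbrev CyclicPow (p j : ℕ) : Type u := ULift.{u} (Multiplicative (ZMod (p ^ (j + 1))))

/-- The subgroup of order `p ^ j` of the cyclic group of order `p ^ (j + 1)`. -/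
abbrev cyclicPowTorsion (p j : ℕ) : Subgroup (CyclicPow.{u} p j) := (powMonoidHom (p ^ j)).ker

theorem cyc_cyclicPow (p : Nat.Primes) (j : ℕ) : Cyc (CyclicPow.{u} p j) := by
  have : NeZero ((p : ℕ) ^ (j + 1)) := ⟨pow_ne_zero _ p.2.ne_zero⟩
  exact ⟨inferInstance, inferInstance,
    isCyclic_of_surjective MulEquiv.ulift.symm MulEquiv.ulift.symm.surjective⟩

theorem card_cyclicPow (p j : ℕ) : Nat.card (CyclicPow.{u} p j) = p ^ (j + 1) := by
  rw [Nat.card_congr (Equiv.ulift.trans Multiplicative.toAdd), Nat.card_zmod]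

variable {F : TopGroupClass.{u}}

/-- The exponent at `p` of the generalized natural number of a transfer system: the least `j` such
that the cyclic group of order `p ^ j` is related to that of order `p ^ (j + 1)`. -/
noncomputable def TransferSystem.exponent (T : TransferSystem F) : GenNat := fun p =>
  ⨅ (j : ℕ) (_ : T.rel (CyclicPow.{u} p j) (cyclicPowTorsion p j)), (j : ℕ∞)

theorem TransferSystem.exponent_le_of_rel {T : TransferSystem F} {p : Nat.Primes} {j : ℕ}
    (h : T.rel (CyclicPow.{u} p j) (cyclicPowTorsion p j)) : T.exponent p ≤ j :=
  iInf₂_le j h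

theorem TransferSystem.exists_rel_of_exponent_ne_top {T : TransferSystem F} {p : Nat.Primes}
    (h : T.exponent p ≠ ⊤) :
    ∃ j : ℕ, T.exponent p = j ∧ T.rel (CyclicPow.{u} p j) (cyclicPowTorsion p j) := by
  classical
  have hex : ∃ j, T.rel (CyclicPow.{u} p j) (cyclicPowTorsion p j) := by
    by_contra! hno
    exact h (by simp [TransferSystem.exponent, hno])
  refine ⟨Nat.find hex, le_antisymm (exponent_le_of_rel (Nat.find_spec hex)) ?_,
    Nat.find_spec hex⟩
  exact le_iInf₂ fun j hj => by exact_mod_cast Nat.find_min' hex hj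

/-! ### A transfer system is determined by its exponents -/

/-- In prime index `p`, a single relation between cyclic `p`-groups suffices: the subgroup is the
pullback of the one of index `p` in the cyclic group of order `p ^ (j + 1)`. -/
theorem TransferSystem.rel_of_index_prime (hF : IsAbelianLieClass F) (T : TransferSystem F)
    {H : Type u} [CommGroup H] [TopologicalSpace H] (hH : F H) {K : Subgroup H}
    (ho : IsOpen (K : Set H)) {p : Nat.Primes} (hK : K.index = p) {j : ℕ}
    (hj : T.rel (CyclicPow.{u} p j) (cyclicPowTorsion p j))
    (htor : ∀ x : H, x ^ (p : ℕ) ^ j = 1 → x ∈ K) : T.rel H K := by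
  obtain ⟨φ, hφ⟩ := exists_hom_zmod_of_index_prime p.2 hK htor
  let θ : H →* CyclicPow.{u} p j := MulEquiv.ulift.symm.toMonoidHom.comp φ
  have hθ : ∀ x, θ x ^ (p : ℕ) ^ j = 1 ↔ x ∈ K := by
    intro x
    rw [hφ]
    exact EmbeddingLike.map_eq_one_iff (f := MulEquiv.ulift.symm) (x := φ x ^ (p : ℕ) ^ j)
  have hcont : Continuous θ := by
    have := (hF.abLie hH).isTopologicalGroup
    obtain ⟨D, hDo, hDle, hDdiv⟩ := (hF.abLie hH).exists_divisible
    -- `θ` is trivial on the open divisible subgroup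
    refine continuous_of_continuousAt_one θ ?_
    refine continuousAt_const.congr (f := fun _ => 1) ?_
    filter_upwards [hDo.mem_nhds D.one_mem] with x hx
    obtain ⟨y, hy, rfl⟩ := hDdiv _ (pow_ne_zero j p.2.ne_zero) x hx
    rw [map_pow, (hθ y).2 (hDle K ho hy)]
  have := T.pullback hH θ hcont hj
  rwa [show (cyclicPowTorsion p j).comap θ = K from Subgroup.ext hθ] at this

/-- An element violating the conclusion would, after passing to a power of prime power order,
give a pullback of `K` to a cyclic group that contradicts the minimality of the exponent. -/
theorem TransferSystem.mem_of_rel (hF : IsAbelianLieClass F) {T : TransferSystem F}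
    {H : Type u} [CommGroup H] [TopologicalSpace H] {K : Subgroup H} (h : T.rel H K) {x : H}
    (hx : DividesGen (orderOf x) T.exponent) : x ∈ K := by
  by_contra hxK
  obtain ⟨p, k, y, hp, hyK, hypK, hord, hdvd⟩ := exists_prime_pow_order_not_mem hx.1 hxK
  obtain ⟨p, rfl⟩ : ∃ q : Nat.Primes, (q : ℕ) = p := ⟨⟨p, hp⟩, rfl⟩
  -- the homomorphism sending a generator of the cyclic group to `y`
  let f : ZMod ((p : ℕ) ^ (k + 1)) →+ Additive H :=
    ZMod.lift _ ⟨zmultiplesHom (Additive H) (Additive.ofMul y), by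
      have : y ^ (p : ℕ) ^ (k + 1) = 1 := by rw [← hord]; exact pow_orderOf_eq_one y
      simp only [zmultiplesHom_apply, natCast_zsmul]
      exact this⟩
  let θ : CyclicPow.{u} p k →* H :=
    (AddMonoidHom.toMultiplicativeLeft f).comp MulEquiv.ulift.toMonoidHom
  have hy : ∀ a : ℤ, y ^ a ∈ K ↔ (p : ℤ) ∣ a := by
    intro a
    refine ⟨fun ha => ?_, ?_⟩
    · by_contra hpa
      refine hyK (mem_of_pow_mem_of_coprime (m := a.natAbs) ?_ ?_ hypK)
      · exact ((Nat.Prime.coprime_iff_not_dvd p.2).2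
          (fun h => hpa (Int.natCast_dvd.2 h))).symm
      · rcases Int.natAbs_eq a with h | h
        · rwa [h, zpow_natCast] at ha
        · rwa [h, zpow_neg, zpow_natCast, inv_mem_iff] at ha
    · rintro ⟨b, rfl⟩
      rw [zpow_mul, zpow_natCast]
      exact K.zpow_mem hypK b
  have hcomap : K.comap θ = cyclicPowTorsion p k := by
    ext ⟨c⟩
    obtain ⟨a, ha⟩ := ZMod.intCast_surjective (Multiplicative.toAdd c)
    obtain rfl : Multiplicative.ofAdd (a : ZMod ((p : ℕ) ^ (k + 1))) = c := ha
    have hθ : θ ⟨Multiplicative.ofAdd (a : ZMod ((p : ℕ) ^ (k + 1)))⟩ = y ^ a := by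
      change (f (a : ZMod ((p : ℕ) ^ (k + 1)))).toMul = _
      rw [ZMod.lift_coe]
      rfl
    rw [Subgroup.mem_comap, hθ, hy, MonoidHom.mem_ker, powMonoidHom_apply, ← ULift.down_inj]
    change _ ↔ (p : ℕ) ^ k • (a : ZMod ((p : ℕ) ^ (k + 1))) = 0
    have hmul : (p : ℕ) ^ k • (a : ZMod ((p : ℕ) ^ (k + 1))) =
        (((p : ℤ) ^ k * a : ℤ) : ZMod ((p : ℕ) ^ (k + 1))) := by
      rw [nsmul_eq_mul]; push_cast; rfl
    rw [hmul, ZMod.intCast_zmod_eq_zero_iff_dvd, Nat.cast_pow, pow_succ,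
      mul_dvd_mul_iff_left (pow_ne_zero _ (by exact_mod_cast p.2.ne_zero))]
  have := exponent_le_of_rel (hcomap ▸ T.pullback (hF.of_cyc (cyc_cyclicPow p k)) θ
    continuous_of_discreteTopology h)
  have h2 := dividesGen_prime_pow_iff.1 (hord ▸ hx.of_dvd hdvd)
  have h3 : k + 1 ≤ k := by exact_mod_cast h2.trans this
  omega

/-- Induction on the index: `K` has prime index in some `L`, and the hypothesis on `K` passes to
`K ≤ L` and to `L ≤ H`. -/
theorem TransferSystem.rel_of_forall_mem (hF : IsAbelianLieClass F) (T : TransferSystem F)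
    {H : Type u} [CommGroup H] [TopologicalSpace H] (hH : F H) {K : Subgroup H}
    (hc : IsClosed (K : Set H)) (hfin : K.FiniteIndex)
    (hmem : ∀ x : H, DividesGen (orderOf x) T.exponent → x ∈ K) : T.rel H K := by
  induction hn : K.index using Nat.strong_induction_on generalizing K with
  | _ n ih =>
    subst hn
    by_cases hK : K = ⊤
    · rw [hK]
      exact T.refl H hH
    obtain ⟨p, L, hp, hKL, hrel, hlt⟩ := exists_relIndex_prime hK
    obtain ⟨p, rfl⟩ : ∃ q : Nat.Primes, (q : ℕ) = p := ⟨⟨p, hp⟩, rfl⟩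
    have := (hF.abLie hH).isTopologicalGroup
    have hKo := K.isOpen_of_isClosed_of_finiteIndex hc
    have hLo : IsOpen (L : Set H) := Subgroup.isOpen_mono hKL hKo
    have hLc : IsClosed (L : Set H) := L.isClosed_of_isOpen hLo
    have hLfin : L.FiniteIndex := Subgroup.finiteIndex_of_le hKL
    refine T.trans hKL ?_ (ih _ hlt hLc hLfin (fun x hx => hKL (hmem x hx)) rfl)
    have hFL : F L := hF.subgroup hH hLc hLfin
    have hKLo : IsOpen ((K.subgroupOf L : Subgroup L) : Set L) :=
      hKo.preimage continuous_subtype_val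
    have hindex : (K.subgroupOf L).index = p := hrel
    have htor : ∀ x : L, DividesGen (orderOf x) T.exponent → x ∈ K.subgroupOf L := by
      intro x hx
      refine Subgroup.mem_subgroupOf.2 (hmem x ?_)
      rwa [Subgroup.orderOf_coe]
    -- if the exponent at `p` were infinite, `K` would contain all `p`-power torsion of `L`
    have htop : T.exponent p ≠ ⊤ := by
      intro htop
      obtain ⟨y, hy, hyK⟩ := (hF.abLie hFL).exists_orderOf_ne_zero_not_mem hKLo
        (fun h => p.2.one_lt.ne' (by rw [← hindex, h, Subgroup.index_top]))
      obtain ⟨q, k, z, hq, hzK, hzqK, hord, -⟩ := exists_prime_pow_order_not_mem hy hyK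
      have hzp : z ^ (p : ℕ) ∈ K.subgroupOf L := hindex ▸ (K.subgroupOf L).pow_index_mem z
      have hqp : q = p := by
        by_contra hne
        exact hzK (mem_of_pow_mem_of_coprime ((Nat.coprime_primes hq p.2).2 hne) hzqK hzp)
      refine hzK (htor z ?_)
      rw [hord, hqp, dividesGen_prime_pow_iff, htop]
      exact le_top
    obtain ⟨j, hj, hjrel⟩ := T.exists_rel_of_exponent_ne_top htop
    refine T.rel_of_index_prime hF hFL hKLo hindex hjrel fun x hx => htor x ?_
    exact (dividesGen_prime_pow_iff.2 hj.ge).of_dvd (orderOf_dvd_of_pow_eq_one hx)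

/-- A transfer system is determined by its exponents. -/
theorem TransferSystem.rel_iff (hF : IsAbelianLieClass F) (T : TransferSystem F)
    {H : Type u} [Group H] [TopologicalSpace H] {K : Subgroup H} :
    T.rel H K ↔ F H ∧ IsClosed (K : Set H) ∧ K.FiniteIndex ∧
      ∀ x : H, DividesGen (orderOf x) T.exponent → x ∈ K := by
  by_cases hH : F H
  · let _ : CommGroup H := { ‹Group H› with mul_comm := (hF.abLie hH).2 }
    exact ⟨fun h => ⟨hH, T.isClosed h, T.finiteIndex h, fun x => T.mem_of_rel hF h⟩,
      fun ⟨_, hc, hf, h⟩ => T.rel_of_forall_mem hF hH hc hf h⟩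
  · exact ⟨fun h => absurd (T.mem_right h) hH, fun h => absurd h.1 hH⟩

/-! ### The transfer system of a generalized natural number -/

/-- The transfer system of a generalized natural number `N`: a closed subgroup of finite index is
related to the whole group when it contains all elements whose order divides `N`. -/
def TransferSystem.ofGenNat (hF : IsAbelianLieClass F) (N : GenNat) : TransferSystem F where
  rel H _ _ K := F H ∧ IsClosed (K : Set H) ∧ K.FiniteIndex ∧
    ∀ x : H, DividesGen (orderOf x) N → x ∈ K
  mem_right h := h.1
  mem_left h := hF.subgroup h.1 h.2.1 h.2.2.1
  isClosed h := h.2.1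
  finiteIndex h := h.2.2.1
  refl H _ _ hH := ⟨hH, isClosed_univ, inferInstance, fun _ _ => Subgroup.mem_top _⟩
  trans := by
    rintro H _ _ L K hLK ⟨-, hLc, hLf, hL⟩ ⟨hH, hKc, hKf, hK⟩
    refine ⟨hH, ?_, ⟨?_⟩, fun x hx => ?_⟩
    · have := hKc.isClosedEmbedding_subtypeVal.isClosedMap _ hLc
      convert this
      ext x
      exact ⟨fun hx => ⟨⟨x, hLK hx⟩, hx, rfl⟩, fun ⟨y, hy, hyx⟩ => hyx ▸ hy⟩
    · rw [← Subgroup.relIndex_mul_index hLK]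
      exact mul_ne_zero hLf.index_ne_zero hKf.index_ne_zero
    · exact Subgroup.mem_subgroupOf.1 (hL ⟨x, hK x hx⟩ (by rwa [Subgroup.orderOf_mk]))
  pullback := by
    rintro G H _ _ _ _ K hG θ hθ ⟨-, hc, hf, hK⟩
    refine ⟨hG, hc.preimage hθ, ⟨?_⟩,
      fun x hx => hK _ (hx.of_dvd (orderOf_map_dvd θ x))⟩
    rw [← Subgroup.relIndex_top_right, ← Subgroup.comap_top θ]
    exact Subgroup.relIndex_comap_ne_zero θ (by
      rw [Subgroup.relIndex_top_right]; exact hf.index_ne_zero)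

theorem TransferSystem.ofGenNat_rel_cyclicPow_iff (hF : IsAbelianLieClass F) {N : GenNat}
    {p : Nat.Primes} {j : ℕ} :
    (ofGenNat hF N).rel (CyclicPow.{u} p j) (cyclicPowTorsion p j) ↔ N p ≤ j := by
  obtain ⟨_, _, _⟩ := cyc_cyclicPow.{u} p j
  refine ⟨fun ⟨_, _, _, h⟩ => ?_, fun h => ⟨hF.of_cyc (cyc_cyclicPow p j), isClosed_discrete _,
    inferInstance, fun x hx => ?_⟩⟩
  · by_contra! hlt
    obtain ⟨g, hg⟩ := IsCyclic.exists_ofOrder_eq_natCard (α := CyclicPow.{u} p j)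
    rw [card_cyclicPow] at hg
    have hgt : g ^ (p : ℕ) ^ j = 1 := h g (by
      rw [hg, dividesGen_prime_pow_iff]
      exact_mod_cast Order.add_one_le_of_lt hlt)
    have := orderOf_dvd_of_pow_eq_one hgt
    rw [hg, Nat.pow_dvd_pow_iff_le_right p.2.one_lt] at this
    omega
  · obtain ⟨i, -, hord⟩ :=
      (Nat.dvd_prime_pow p.2).1 (card_cyclicPow.{u} p j ▸ orderOf_dvd_natCard x)
    rw [hord, dividesGen_prime_pow_iff] at hx
    have hij : i ≤ j := by exact_mod_cast hx.trans h
    change x ^ (p : ℕ) ^ j = 1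
    rw [← orderOf_dvd_iff_pow_eq_one, hord]
    exact pow_dvd_pow _ hij

theorem TransferSystem.exponent_ofGenNat (hF : IsAbelianLieClass F) (N : GenNat) :
    (ofGenNat hF N).exponent = N := by
  funext p
  refine le_antisymm ?_ (le_iInf₂ fun j hj => (ofGenNat_rel_cyclicPow_iff hF).1 hj)
  induction hN : N p using ENat.recTopCoe with
  | top => exact le_top
  | coe n => exact exponent_le_of_rel ((ofGenNat_rel_cyclicPow_iff hF).2 hN.le)

/-- Transfer systems for a class of abelian compact Lie groups are classified by generalized
natural numbers, with the reversed order. -/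
noncomputable def TransferSystem.exponentIso (hF : IsAbelianLieClass F) :
    TransferSystem F ≃o GenNatᵒᵈ where
  toFun T := OrderDual.toDual T.exponent
  invFun N := ofGenNat hF (OrderDual.ofDual N)
  left_inv T := by
    refine le_antisymm ?_ ?_ <;> intro H _ _ K h
    · exact (T.rel_iff hF).2 h
    · exact (T.rel_iff hF).1 h
  right_inv N := exponent_ofGenNat hF N
  map_rel_iff' := by
    intro T T'
    change T'.exponent ≤ T.exponent ↔ T ≤ T'
    refine ⟨fun h H _ _ K hK => ?_, fun h p => ?_⟩
    · rw [rel_iff hF] at hK ⊢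
      exact ⟨hK.1, hK.2.1, hK.2.2.1, fun x hx => hK.2.2.2 x (hx.mono h)⟩
    · exact le_iInf₂ fun j hj => exponent_le_of_rel (h _ _ hj)

end GlobalTransfer

open GlobalTransfer
theorem theorem7p2 :
    ∃ (U : TransferSystem AbLie.{u} ≃o TransferSystem Cyc.{u})
      (Φ : TransferSystem Cyc.{u} ≃o GenNatᵒᵈ),
      -- `U` is restriction to finite cyclic groups
      (∀ (T : TransferSystem AbLie.{u}) (H : Type u) [Group H] [TopologicalSpace H]
        (K : Subgroup H), (U T).rel H K ↔ Cyc H ∧ T.rel H K) ∧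
      -- the transfer system of abelian compact Lie groups corresponding to `N`
      (∀ (N : GenNat) (H : Type u) [Group H] [TopologicalSpace H], AbLie H →
        ∀ K : Subgroup H, IsClosed (K : Set H) → K.FiniteIndex →
          ((U.symm (Φ.symm (OrderDual.toDual N))).rel H K ↔
            ∀ x : H, DividesGen (orderOf x) N → x ∈ K)) := by
  let eA := TransferSystem.exponentIso isAbelianLieClass_abLie.{u}
  let eC := TransferSystem.exponentIso isAbelianLieClass_cyc.{u}
  refine ⟨eA.trans eC.symm, eC, fun T H _ _ K => ?_, fun N H _ _ hH K hc hf => ?_⟩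
  · rw [T.rel_iff isAbelianLieClass_abLie]
    change Cyc H ∧ _ ↔ _
    exact ⟨fun h => ⟨h.1, isAbelianLieClass_abLie.of_cyc h.1, h.2⟩, fun h => ⟨h.1, h.2.2⟩⟩
  · have hsymm : (eA.trans eC.symm).symm (eC.symm (OrderDual.toDual N)) =
        TransferSystem.ofGenNat isAbelianLieClass_abLie N := by
      change eA.symm (eC (eC.symm (OrderDual.toDual N))) = _
      rw [OrderIso.apply_symm_apply]
      rfl
    rw [hsymm]
    exact ⟨fun h => h.2.2.2, fun h => ⟨hH, hc, hf, h⟩⟩
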